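/- **Rapid mixing for commuting RFTS.** Let $|\psi^{(s)}\rangle$, $s\in\mathbb N$, be a scalable family of pure states: $|\psi^{(s)}\rangle$ is a unit vector in $\mathcal H^{(s)}=\bigotimes_{j=1}^{N^{(s)}}\mathbb C^{d}$, where $N^{(s)}$ is monotonically increasing and unbounded in $s$, and $\mathcal H^{(s)}$ carries a neighborhood structure, that is, a list of sets of subsystems $\mathcal N^{(s)}_k\subseteq\{1,\dots,N^{(s)}\}$, $k=1,\dots,K^{(s)}$, such that for some constants $b,B>0$ one has $K^{(s)}\le b\,N^{(s)}$ and $\dim\mathcal H_{\mathcal N^{(s)}_k}\le B$ for all $k,s$. Suppose that for every $s$ the state $\rho^{(s)}=|\psi^{(s)}\rangle\langle\psi^{(s)}|$ is made robustly finite-time stable (RFTS) by mutually commuting neighborhood maps $\mathcal E^{(s)}_k$, $k=1,\dots,K^{(s)}$: each $\mathcal E_k^{(s)}$ is a completely positive trace-preserving (CPTP) map that acts as the identity outside $\mathcal N^{(s)}_k$ and satisfies $\mathcal E^{(s)}_k(\rho^{(s)})=\rho^{(s)}$, and the composition of all these maps, in any order, sends every density operator to $\rho^{(s)}$. Assume that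 there is $\nu>0$ such that every eigenvalue $\lambda$ of every $\mathcal E^{(s)}_k$ satisfies $\lambda=1$ or $|\lambda|<1-\nu$. Put $\mathcal L^{(s)}=\sum_k(\mathcal E^{(s)}_k-\mathcal I)$. Then: 1. The $\mathcal L^{(s)}$ are quasi-local Liouvillians of bounded norm: there is a constant $C$, independent of $s$, such that each $\mathcal L^{(s)}$ is a sum over $k$ of generators $\mathcal L^{(s)}_{\mathcal N_k}\otimes\mathcal I$ with $\mathcal L^{(s)}_{\mathcal N_k}$ of Gorini–Kossakowski–Sudarshan–Lindblad form on the subsystems in $\mathcal N^{(s)}_k$ and with trace-norm-induced operator norm at most $C$. 2. They are rapidly mixing with respect to $|\psi^{(s)}\rangle$: the maps $e^{\mathcal L^{(s)}t}$, $t\ge0$, are CPTP; $\rho^{(s)}$ is the unique equilibrium state, and the spectral projection $\mathcal E_\phi^{(s)}$ of $\mathcal L^{(s)}$ onto the eigenvalues of zero real part is $X\mapsto \mathrm{tr}(X)\,\rho^{(s)}$; and there is a constant $c>0$ such that for all $s$ and all $t\ge0$ the contraction coefficient satisfies $$\eta\big(e^{\mathcal L^{(s)}t}\big):=\tfrac12\sup_{\rho\ge0,\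 \mathrm{tr}\rho=1}\big\|(\mathcal I-\mathcal E^{(s)}_\phi)\,e^{\mathcal L^{(s)}t}(\rho)\big\|_1\ \le\ c\,N^{(s)}e^{-\nu t}.$$ -/

import Mathlib

open scoped ComplexOrder

noncomputable section

namespace QLMixing

/-! ### States, channels and generators on a finite-dimensional Hilbert space `ℂ^n` -/

section General

/-- Linear maps on the space of operators (superoperators) on `ℂ^n`. -/
abbrev SuperOp (n : Type) : Type := Module.End ℂ (Matrix n n ℂ)

/-- Density operators: positive semidefinite and of unit trace. -/
def IsDensity {n : Type} [Fintype n] (ρ : Matrix n n ℂ) : Prop :=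
  ρ.PosSemidef ∧ ρ.trace = 1

/-- The rank-one operator `|ψ⟩⟨ψ|`. -/
def pureState {n : Type} [Fintype n] (ψ : EuclideanSpace ℂ n) : Matrix n n ℂ :=
  Matrix.of fun x y => ψ x * star (ψ y)

/-- The trace norm `‖A‖₁ = tr √(A† A)`, the sum of the singular values of `A`. -/
def traceNorm {n : Type} [Fintype n] [DecidableEq n] (A : Matrix n n ℂ) : ℝ :=
  ∑ i, √((Matrix.isHermitian_conjTranspose_mul_self A).eigenvalues i)

/-- The map `id_k ⊗ Φ` on `k × k` block matrices with blocks in `B(ℂ^n)`. -/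
def ampliation {n : Type} (k : ℕ) (Φ : SuperOp n)
    (X : Matrix (Fin k × n) (Fin k × n) ℂ) : Matrix (Fin k × n) (Fin k × n) ℂ :=
  Matrix.of fun p q => Φ (Matrix.of fun x y => X (p.1, x) (q.1, y)) p.2 q.2

/-- Completely positive trace-preserving maps. -/
def IsCPTP {n : Type} [Fintype n] (Φ : SuperOp n) : Prop :=
  (∀ (k : ℕ) (X : Matrix (Fin k × n) (Fin k × n) ℂ),
    X.PosSemidef → (ampliation k Φ X).PosSemidef) ∧
  ∀ X : Matrix n n ℂ, (Φ X).trace = X.trace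

/-- Liouvillians: generators of Gorini-Kossakowski-Sudarshan-Lindblad form
`X ↦ -i[H, X] + ∑ j, (L_j X L_j† - ½ {L_j† L_j, X})`. -/
def IsLiouvillian {n : Type} [Fintype n] (G : SuperOp n) : Prop :=
  ∃ (H : Matrix n n ℂ) (m : ℕ) (L : Fin m → Matrix n n ℂ), H.IsHermitian ∧
    ∀ X : Matrix n n ℂ, G X = -Complex.I • (H * X - X * H) +
      ∑ j, (L j * X * (L j).conjTranspose -
        (1 / 2 : ℂ) • ((L j).conjTranspose * L j * X + X * ((L j).conjTranspose * L j)))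

/-- The semigroup `e^{tG}`; the exponential is that of the matrix of `t G` in the standard basis
of the operator space. -/
def semigroup {n : Type} [Fintype n] [DecidableEq n] (G : SuperOp n) (t : ℝ) : SuperOp n :=
  (LinearMap.toMatrixAlgEquiv (Matrix.stdBasis ℂ n n)).symm
    (NormedSpace.exp ((t : ℂ) • LinearMap.toMatrixAlgEquiv (Matrix.stdBasis ℂ n n) G))

/-- The sum of the (generalized) eigenspaces of `G` for the eigenvalues with zero real part. -/
def peripheralSpace {n : Type} (G : SuperOp n) : Submodule ℂ (Matrix n n ℂ) :=
  ⨆ μ ∈ {μ : ℂ | μ.re = 0}, G.maxGenEigenspace μ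

/-- The sum of the (generalized) eigenspaces of `G` for the other eigenvalues. -/
def nonperipheralSpace {n : Type} (G : SuperOp n) : Submodule ℂ (Matrix n n ℂ) :=
  ⨆ μ ∈ {μ : ℂ | μ.re ≠ 0}, G.maxGenEigenspace μ

theorem isCompl_peripheralSpace {n : Type} [Fintype n] (G : SuperOp n) :
    IsCompl (peripheralSpace G) (nonperipheralSpace G) := by
  constructor
  · refine (Module.End.independent_maxGenEigenspace G).disjoint_biSup_biSup ?_
    rw [Set.disjoint_left]
    intro μ h1 h2
    exact h2 h1
  · rw [codisjoint_iff, eq_top_iff, ← Module.End.iSup_maxGenEigenspace_eq_top G]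
    refine iSup_le fun μ => ?_
    by_cases h : μ.re = 0
    · exact le_sup_of_le_left (le_iSup₂_of_le μ h le_rfl)
    · exact le_sup_of_le_right (le_iSup₂_of_le μ h le_rfl)

/-- The spectral projection `E_φ` of the generator `G` onto its peripheral part. -/
def peripheralProj {n : Type} [Fintype n] (G : SuperOp n) : SuperOp n :=
  Submodule.projection (peripheralSpace G) (nonperipheralSpace G) (isCompl_peripheralSpace G)

/-- The contraction coefficient `η(e^{tG}) = ½ sup_ρ ‖(I - E_φ)(e^{tG}(ρ))‖₁`, the supremum being
over all density operators (a compact set, so that the supremum is finite). -/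
def contractionCoeff {n : Type} [Fintype n] [DecidableEq n] (G : SuperOp n) (t : ℝ) : ℝ :=
  (1 / 2) * sSup {r : ℝ | ∃ ρ : Matrix n n ℂ, IsDensity ρ ∧
    r = traceNorm (semigroup G t ρ - peripheralProj G (semigroup G t ρ))}

/-- `ρ` is the unique equilibrium state of `G`, and `G` has no other peripheral part: the
peripheral projection is `X ↦ tr(X) ρ`. -/
structure IsUniqueEquilibrium {n : Type} [Fintype n] (G : SuperOp n) (ρ : Matrix n n ℂ) :
    Prop where
  stationary : G ρ = 0
  unique : ∀ σ : Matrix n n ℂ, IsDensity σ → G σ = 0 → σ = ρ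
  peripheral : ∀ X : Matrix n n ℂ, peripheralProj G X = X.trace • ρ

end General

/-! ### Multipartite systems and quasi-locality -/

section Multipartite

/-- Basis labels of `⨂_{i < N} ℂ^d`. -/
abbrev Config (N d : ℕ) : Type := Fin N → Fin d

/-- Basis labels of `⨂_{i ∈ S} ℂ^d` for a set `S` of subsystems. -/
abbrev LocalConfig {N : ℕ} (d : ℕ) (S : Finset (Fin N)) : Type := {i // i ∈ S} → Fin d

/-- The label that agrees with `a` on `S` and with `z` outside `S`. -/
def glue {N d : ℕ} (S : Finset (Fin N)) (a : LocalConfig d S) (z : Config N d) : Config N d :=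
  fun i => if h : i ∈ S then a ⟨i, h⟩ else z i

/-- The map `Φ ⊗ id` on the whole system, where `Φ` acts on the subsystems in `S` and the identity
map on the operators of the other ones. -/
def extend {N d : ℕ} (S : Finset (Fin N)) (Φ : SuperOp (LocalConfig d S)) :
    SuperOp (Config N d) where
  toFun X := Matrix.of fun x y =>
    Φ (Matrix.of fun a b => X (glue S a x) (glue S b y)) (fun i => x i) (fun i => y i)
  map_add' X Y := by
    ext x y
    exact congrFun (congrFun (map_add Φ (Matrix.of fun a b => X (glue S a x) (glue S b y))
      (Matrix.of fun a b => Y (glue S a x) (glue S b y))) _) _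
  map_smul' c X := by
    ext x y
    exact congrFun (congrFun
      (map_smul Φ c (Matrix.of fun a b => X (glue S a x) (glue S b y))) _) _

/-- CPTP maps of the form `E_S ⊗ id`. -/
def IsNeighborhoodMap {N d : ℕ} (S : Finset (Fin N)) (E : SuperOp (Config N d)) : Prop :=
  ∃ Φ : SuperOp (LocalConfig d S), IsCPTP Φ ∧ E = extend S Φ

/-- Generators of the form `L_S ⊗ id` with `L_S` a Liouvillian on the subsystems in `S`. -/
def IsNeighborhoodLiouvillian {N d : ℕ} (S : Finset (Fin N)) (G : SuperOp (Config N d)) : Prop :=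
  ∃ Γ : SuperOp (LocalConfig d S), IsLiouvillian Γ ∧ G = extend S Γ

/-- `G` is a quasi-local Liouvillian `∑ k, L_k`, each `L_k` being a neighborhood Liouvillian on the
`k`-th neighborhood whose norm, as an operator on the trace class, is at most `C`. -/
def IsBoundedQLLiouvillian {N d K : ℕ} (nbhd : Fin K → Finset (Fin N)) (C : ℝ)
    (G : SuperOp (Config N d)) : Prop :=
  ∃ L : Fin K → SuperOp (Config N d), G = ∑ k, L k ∧ ∀ k,
    IsNeighborhoodLiouvillian (nbhd k) (L k) ∧
    ∀ X : Matrix (Config N d) (Config N d) ℂ, traceNorm (L k X) ≤ C * traceNorm X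

/-- The pure state `ψ` is made robustly finite-time stable by the maps `E_k`, one for each
neighborhood: each map is a neighborhood map leaving `|ψ⟩⟨ψ|` invariant, and composing all of them,
in any order, sends every state to `|ψ⟩⟨ψ|`. -/
structure MadeRFTSBy {N d K : ℕ} (nbhd : Fin K → Finset (Fin N))
    (ψ : EuclideanSpace ℂ (Config N d)) (E : Fin K → SuperOp (Config N d)) : Prop where
  neighborhoodMap : ∀ k, IsNeighborhoodMap (nbhd k) (E k)
  invariant : ∀ k, E k (pureState ψ) = pureState ψ
  attractive : ∀ (π : Equiv.Perm (Fin K)) (σ : Matrix (Config N d) (Config N d) ℂ),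
    IsDensity σ → (List.ofFn fun k => E (π k)).prod σ = pureState ψ

/-- A scalable family of pure states with neighborhood structures. The neighborhood structure at
`s` is a list of `K s` sets of subsystems. -/
structure ScalableFamily where
  /-- the dimension of each subsystem -/
  d : ℕ
  /-- the number of subsystems -/
  N : ℕ → ℕ
  N_monotone : Monotone N
  N_unbounded : ∀ m, ∃ s, m ≤ N s
  /-- the states -/
  ψ : (s : ℕ) → EuclideanSpace ℂ (Config (N s) d)
  norm_ψ : ∀ s, ‖ψ s‖ = 1
  /-- the number of neighborhoods -/
  K : ℕ → ℕ
  /-- the neighborhoods -/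
  nbhd : (s : ℕ) → Fin (K s) → Finset (Fin (N s))
  card_nbhds : ∃ b : ℝ, 0 < b ∧ ∀ s, (K s : ℝ) ≤ b * N s
  dim_nbhd : ∃ B : ℕ, 0 < B ∧ ∀ s k, d ^ (nbhd s k).card ≤ B

/-- The family of semigroups generated by `G s` consists of CPTP maps and is rapidly mixing with
respect to the states of the family, with the constants `c`, `δ`, `γ`:
`η(e^{t G s}) ≤ c (N s)^δ e^{-γ t}` for all `t ≥ 0`. -/
structure IsRapidlyMixing (F : ScalableFamily) (G : (s : ℕ) → SuperOp (Config (F.N s) F.d))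
    (c δ γ : ℝ) : Prop where
  c_pos : 0 < c
  δ_pos : 0 < δ
  γ_pos : 0 < γ
  cptp : ∀ s t, 0 ≤ t → IsCPTP (semigroup (G s) t)
  equilibrium : ∀ s, IsUniqueEquilibrium (G s) (pureState (F.ψ s))
  bound : ∀ s t, 0 ≤ t →
    contractionCoeff (G s) t ≤ c * (F.N s : ℝ) ^ δ * Real.exp (-γ * t)

end Multipartite

end QLMixing

end

/-!
For a channel `E k` one has `e^{t(E k - 1)} = e^{-t} + e^{-t} (e^{t E k} - 1)`, and
`e^{t E k} - 1 = E k * H k`, both sides being completely positive, where `H k` commutes with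
everything that commutes with `E k`. Expand the product over `k` of these factors. Since the
composition of all `E k` is `X ↦ tr(X) ρ`, the term made of the second summands only is
`(1 - e^{-t})^K` times `X ↦ tr(X) ρ`, whatever the maps `H k` are. The other terms add up to a
completely positive map which multiplies traces by `1 - (1 - e^{-t})^K ≤ K e^{-t}`; it therefore
contracts the trace norm by this factor, and on traceless operators it agrees with `e^{tL}`.

So the mixing rate is `1` whatever the spectral gap. A larger rate `ν > 1` can only be asked for
when no `E k` has the eigenvalue `0`; then `X ↦ tr(X) ρ` is injective, and there is nothing to mix.
-/

namespace QLMixing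

open scoped Matrix

section CompletelyPositive

variable {n : Type}

/-- Completely positive maps: all the maps `id_k ⊗ Φ` preserve positive semidefiniteness. -/
def IsCP (Φ : SuperOp n) : Prop :=
  ∀ (k : ℕ) (X : Matrix (Fin k × n) (Fin k × n) ℂ),
    X.PosSemidef → (ampliation k Φ X).PosSemidef

namespace IsCP

variable {Φ Ψ : SuperOp n}

theorem one : IsCP (1 : SuperOp n) := fun _ _ hX => hX

theorem zero : IsCP (0 : SuperOp n) := fun _ _ _ => Matrix.PosSemidef.zero

theorem add (hΦ : IsCP Φ) (hΨ : IsCP Ψ) : IsCP (Φ + Ψ) :=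
  fun k X hX => (hΦ k X hX).add (hΨ k X hX)

theorem smul {c : ℂ} (hc : 0 ≤ c) (hΦ : IsCP Φ) : IsCP (c • Φ) :=
  fun k X hX => (hΦ k X hX).smul hc

theorem mul (hΦ : IsCP Φ) (hΨ : IsCP Ψ) : IsCP (Φ * Ψ) :=
  fun k X hX => hΦ k (ampliation k Ψ X) (hΨ k X hX)

theorem pow (hΦ : IsCP Φ) (m : ℕ) : IsCP (Φ ^ m) := by
  induction m with
  | zero => exact pow_zero Φ ▸ one
  | succ m ih => exact pow_succ Φ m ▸ ih.mul hΦ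

theorem list_prod {l : List (SuperOp n)} (h : ∀ Φ ∈ l, IsCP Φ) : IsCP l.prod :=
  List.prod_induction IsCP (fun _ _ => mul) one h

theorem posSemidef_comp_map {ι : Type*} [Finite ι] (hΦ : IsCP Φ) {X : Matrix ι ι (Matrix n n ℂ)}
    (hX : (Matrix.comp ι ι n n ℂ X).PosSemidef) :
    (Matrix.comp ι ι n n ℂ (X.map Φ)).PosSemidef := by
  obtain ⟨k, ⟨e⟩⟩ := Finite.exists_equiv_fin ι
  have hblocks := (hΦ k _ (hX.submatrix (Prod.map e.symm id))).submatrix (Prod.map e id)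
  convert hblocks using 1
  ext ⟨i, x⟩ ⟨j, y⟩
  simp only [Matrix.comp_apply, Matrix.map_apply, Matrix.submatrix_apply, ampliation,
    Prod.map_apply, Matrix.of_apply, Equiv.symm_apply_apply, id_eq]
  rfl

end IsCP

/-- The Choi matrix `∑ a b, |a⟩⟨b| ⊗ Φ(|a⟩⟨b|)` of `Φ`. -/
def choiMatrix [DecidableEq n] (Φ : SuperOp n) : Matrix (n × n) (n × n) ℂ :=
  Matrix.comp n n n n ℂ (Matrix.of fun a b => Φ (Matrix.single a b 1))

theorem apply_eq_sum_mul_choiMatrix [Fintype n] [DecidableEq n] (Φ : SuperOp n) (X : Matrix n n ℂ)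
    (x y : n) : Φ X x y = ∑ a, ∑ b, X a b * choiMatrix Φ (a, x) (b, y) := by
  have hX : X = ∑ a, ∑ b, X a b • Matrix.single a b (1 : ℂ) := by
    simpa only [Matrix.smul_single, smul_eq_mul, mul_one] using Matrix.matrix_eq_sum_single X
  conv_lhs => rw [hX]
  simp only [map_sum, map_smul, Matrix.sum_apply, Matrix.smul_apply, smul_eq_mul]
  rfl

theorem IsCP.posSemidef_choiMatrix [Finite n] [DecidableEq n] {Φ : SuperOp n} (hΦ : IsCP Φ) :
    (choiMatrix Φ).PosSemidef := by
  refine hΦ.posSemidef_comp_map (X := Matrix.of fun a b => Matrix.single a b 1) ?_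
  convert Matrix.posSemidef_vecMulVec_self_star (fun p : n × n => if p.1 = p.2 then (1 : ℂ) else 0)
    using 1
  ext ⟨a, x⟩ ⟨b, y⟩
  by_cases hx : a = x <;> by_cases hy : b = y <;> simp [Matrix.vecMulVec_apply, hx, hy]

variable [Fintype n]

theorem exists_eq_conjTranspose_mul_self {P : Matrix n n ℂ} (hP : P.PosSemidef) :
    ∃ B : Matrix n n ℂ, P = Bᴴ * B := by
  classical
  open scoped MatrixOrder in
  exact CStarAlgebra.nonneg_iff_eq_star_mul_self.mp hP.nonneg

theorem IsCP.exists_kraus {Φ : SuperOp n} (hΦ : IsCP Φ) :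
    ∃ L : n × n → Matrix n n ℂ, ∀ X, Φ X = ∑ r, L r * X * (L r)ᴴ := by
  classical
  obtain ⟨B, hB⟩ := exists_eq_conjTranspose_mul_self hΦ.posSemidef_choiMatrix
  refine ⟨fun r => Matrix.of fun x a => star (B r (a, x)), fun X => ?_⟩
  ext x y
  simp only [apply_eq_sum_mul_choiMatrix Φ X x y, hB, Matrix.sum_apply, Matrix.mul_apply,
    Matrix.conjTranspose_apply, Matrix.of_apply, star_star, Finset.mul_sum, Finset.sum_mul]
  rw [Finset.sum_comm]
  simp_rw [Finset.sum_comm (s := (Finset.univ : Finset n)) (t := (Finset.univ : Finset (n × n)))]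
  exact Finset.sum_congr rfl fun r _ => Finset.sum_congr rfl fun b _ =>
    Finset.sum_congr rfl fun a _ => by ring

theorem sum_conjTranspose_mul_self_eq_one [DecidableEq n] {ι : Type*} [Fintype ι]
    {L : ι → Matrix n n ℂ} (h : ∀ X, (∑ j, L j * X * (L j)ᴴ).trace = X.trace) :
    ∑ j, (L j)ᴴ * L j = 1 := by
  rw [Matrix.ext_iff_trace_mul_right]
  intro X
  rw [one_mul, ← h X, Finset.sum_mul, Matrix.trace_sum, Matrix.trace_sum]
  exact Finset.sum_congr rfl fun j _ => by rw [Matrix.mul_assoc, Matrix.trace_mul_comm]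

theorem IsCPTP.isCP {Φ : SuperOp n} (hΦ : IsCPTP Φ) : IsCP Φ := hΦ.1

theorem IsCPTP.isLiouvillian_sub_one {Φ : SuperOp n} (hΦ : IsCPTP Φ) : IsLiouvillian (Φ - 1) := by
  classical
  obtain ⟨L, hL⟩ := hΦ.isCP.exists_kraus
  have hone : ∑ r, (L r)ᴴ * L r = 1 :=
    sum_conjTranspose_mul_self_eq_one fun X => by rw [← hL, hΦ.2]
  let e := (Fintype.equivFin (n × n)).symm
  refine ⟨0, _, L ∘ e, Matrix.isHermitian_zero, fun X => ?_⟩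
  calc (Φ - 1) X = ∑ r, L r * X * (L r)ᴴ - (1 / 2 : ℂ) • (1 * X + X * 1) := by
        rw [one_mul, mul_one, ← two_smul ℂ X, smul_smul]
        norm_num [hL]
    _ = ∑ r, (L r * X * (L r)ᴴ - (1 / 2 : ℂ) • ((L r)ᴴ * L r * X + X * ((L r)ᴴ * L r))) := by
        rw [← hone, Finset.sum_mul, Finset.mul_sum, ← Finset.sum_add_distrib, Finset.smul_sum,
          Finset.sum_sub_distrib]
    _ = _ := by
        rw [← e.sum_comp]
        simp

end CompletelyPositive

section Extend

variable {N d : ℕ} {S : Finset (Fin N)}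

theorem glue_restrict (x : Config N d) : glue S (fun i => x i) x = x := by
  ext i
  simp [glue]

theorem extend_sub_one (Φ : SuperOp (LocalConfig d S)) : extend S (Φ - 1) = extend S Φ - 1 := by
  ext X x y
  simp [extend, glue_restrict]

theorem IsCP.extend {Φ : SuperOp (LocalConfig d S)} (hΦ : IsCP Φ) : IsCP (extend S Φ) := by
  intro k X hX
  let blocks : Matrix (Fin k × Config N d) (Fin k × Config N d)
      (Matrix (LocalConfig d S) (LocalConfig d S) ℂ) :=
    Matrix.of fun p q => Matrix.of fun a b => X (p.1, glue S a p.2) (q.1, glue S b q.2)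
  have hblocks : (Matrix.comp _ _ _ _ ℂ blocks).PosSemidef :=
    hX.submatrix fun p : (Fin k × Config N d) × LocalConfig d S => (p.1.1, glue S p.2 p.1.2)
  exact (hΦ.posSemidef_comp_map hblocks).submatrix fun p => (p, fun i => p.2 i)

theorem trace_extend {Φ : SuperOp (LocalConfig d S)} (hΦ : ∀ X, (Φ X).trace = X.trace)
    (X : Matrix (Config N d) (Config N d) ℂ) : (extend S Φ X).trace = X.trace := by
  let e := Equiv.piEquivPiSubtypeProd (fun i : Fin N => i ∈ S) fun _ => Fin d
  have glue_e (a a' : LocalConfig d S) (c) : glue S a (e.symm (a', c)) = e.symm (a, c) := by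
    ext i
    by_cases h : i ∈ S <;> simp [glue, e, Equiv.piEquivPiSubtypeProd, h]
  have restrict_e (a : LocalConfig d S) (c) : (fun i : {i // i ∈ S} => e.symm (a, c) i) = a := by
    ext i
    simp [e, Equiv.piEquivPiSubtypeProd]
  have trace_eq (Y : Matrix (Config N d) (Config N d) ℂ) :
      Y.trace = ∑ c, ∑ a, Y (e.symm (a, c)) (e.symm (a, c)) := by
    rw [← Fintype.sum_prod_type_right', e.symm.sum_comp (fun x => Y x x)]
    rfl
  rw [trace_eq, trace_eq]
  refine Finset.sum_congr rfl fun c _ => ?_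
  have hblock := hΦ (Matrix.of fun a b => X (e.symm (a, c)) (e.symm (b, c)))
  simpa only [Matrix.trace, Matrix.diag_apply, Matrix.of_apply, extend, LinearMap.coe_mk,
    AddHom.coe_mk, glue_e, restrict_e] using hblock

theorem IsNeighborhoodMap.isNeighborhoodLiouvillian {E : SuperOp (Config N d)}
    (hE : IsNeighborhoodMap S E) : IsNeighborhoodLiouvillian S (E - 1) := by
  obtain ⟨Φ, hΦ, rfl⟩ := hE
  exact ⟨Φ - 1, hΦ.isLiouvillian_sub_one, (extend_sub_one Φ).symm⟩

theorem IsNeighborhoodMap.isCPTP {E : SuperOp (Config N d)} (hE : IsNeighborhoodMap S E) :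
    IsCPTP E := by
  obtain ⟨Φ, hΦ, rfl⟩ := hE
  exact ⟨hΦ.isCP.extend, trace_extend hΦ.2⟩

end Extend

section PolarDecomposition

theorem exists_linearIsometry_apply_eq {𝕜 E F : Type*} [RCLike 𝕜] [AddCommGroup E] [Module 𝕜 E]
    [NormedAddCommGroup F] [InnerProductSpace 𝕜 F] [FiniteDimensional 𝕜 F] {f g : E →ₗ[𝕜] F}
    (h : ∀ x, ‖f x‖ = ‖g x‖) : ∃ U : F →ₗᵢ[𝕜] F, ∀ x, f x = U (g x) := by
  obtain ⟨s, hs⟩ := g.rangeRestrict.exists_rightInverse_of_surjective g.range_rangeRestrict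
  have g_s (y : g.range) : g (s y) = y := congrArg Subtype.val (LinearMap.congr_fun hs y)
  let U₀ : g.range →ₗᵢ[𝕜] F := ⟨f ∘ₗ s, fun y => by simp [h, g_s]⟩
  refine ⟨U₀.extend, fun x => ?_⟩
  have hU : U₀.extend (g x) = f (s (g.rangeRestrict x)) := U₀.extend_apply (g.rangeRestrict x)
  rw [hU, ← sub_eq_zero, ← map_sub, ← norm_eq_zero, h, map_sub, g_s]
  simp

variable {𝕜 n : Type*} [RCLike 𝕜] [Fintype n] [DecidableEq n]

theorem exists_unitary_mul_eq {A B : Matrix n n 𝕜} (h : Aᴴ * A = Bᴴ * B) :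
    ∃ U ∈ Matrix.unitaryGroup n 𝕜, A = U * B := by
  let toOp := Matrix.toEuclideanCLM (n := n) (𝕜 := 𝕜)
  have hnorm (x) : ‖toOp A x‖ = ‖toOp B x‖ := by
    have hop : star (toOp A) * toOp A = star (toOp B) * toOp B := by
      rw [← map_star, ← map_star, ← map_mul, ← map_mul]
      exact congrArg toOp h
    rw [← sq_eq_sq₀ (norm_nonneg _) (norm_nonneg _),
      ContinuousLinearMap.apply_norm_sq_eq_inner_adjoint_left,
      ContinuousLinearMap.apply_norm_sq_eq_inner_adjoint_left]
    exact congrArg (fun T => RCLike.re (inner 𝕜 (T x) x)) hop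
  obtain ⟨U, hU⟩ := exists_linearIsometry_apply_eq (f := (toOp A).toLinearMap)
    (g := (toOp B).toLinearMap) hnorm
  obtain ⟨W, hW⟩ := EquivLike.surjective toOp U.toContinuousLinearMap
  refine ⟨W, Matrix.mem_unitaryGroup_iff'.mpr (EquivLike.injective toOp ?_),
    EquivLike.injective toOp ?_⟩
  · rw [map_mul, map_star, hW, map_one]
    exact U.adjoint_comp_self
  · rw [map_mul, hW]
    exact ContinuousLinearMap.ext hU

theorem conjTranspose_mul_mul_cancel {V : Matrix n n 𝕜} (hV : V ∈ Matrix.unitaryGroup n 𝕜)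
    (A : Matrix n n 𝕜) : Vᴴ * (V * A) = A := by
  rw [← mul_assoc, ← Matrix.star_eq_conjTranspose, Matrix.mem_unitaryGroup_iff'.mp hV, one_mul]

end PolarDecomposition

section TraceNorm

variable {n : Type} [Fintype n] [DecidableEq n]

theorem exists_polar_decomposition (A : Matrix n n ℂ) :
    ∃ W ∈ Matrix.unitaryGroup n ℂ, ∃ M : Matrix n n ℂ,
      M.PosSemidef ∧ M.trace = traceNorm A ∧ A = W * M := by
  have hA := Matrix.isHermitian_conjTranspose_mul_self A
  let V : Matrix n n ℂ := hA.eigenvectorUnitary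
  have hV : star V * V = 1 := Unitary.coe_star_mul_self _
  let D : Matrix n n ℂ := Matrix.diagonal fun i => (√(hA.eigenvalues i) : ℂ)
  have hD : D.PosSemidef :=
    Matrix.PosSemidef.diagonal fun i => Complex.zero_le_real.mpr (Real.sqrt_nonneg _)
  have hDsq : D * D = Matrix.diagonal (RCLike.ofReal ∘ hA.eigenvalues) := by
    simp only [D, Matrix.diagonal_mul_diagonal, ← Complex.ofReal_mul,
      Real.mul_self_sqrt (A.eigenvalues_conjTranspose_mul_self_nonneg _)]
    rfl
  have hM : (V * D * star V).PosSemidef := hD.mul_mul_conjTranspose_same V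
  have hsq : Aᴴ * A = (V * D * star V)ᴴ * (V * D * star V) := by
    rw [hM.isHermitian.eq]
    calc Aᴴ * A = V * (D * D) * star V := by
          rw [hDsq]
          exact hA.spectral_theorem
      _ = V * D * (star V * V) * D * star V := by rw [hV]; noncomm_ring
      _ = V * D * star V * (V * D * star V) := by noncomm_ring
  obtain ⟨W, hW, hAW⟩ := exists_unitary_mul_eq hsq
  refine ⟨W, hW, _, hM, ?_, hAW⟩
  rw [Matrix.trace_mul_comm, ← mul_assoc, hV, one_mul, Matrix.trace_diagonal, traceNorm]
  push_cast
  rfl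

theorem two_mul_re_trace_mul_le (L W : Matrix n n ℂ) {V M : Matrix n n ℂ}
    (hV : V ∈ Matrix.unitaryGroup n ℂ) (hM : M.PosSemidef) :
    2 * (Vᴴ * (L * (W * M) * Lᴴ)).trace.re ≤
      (L * (W * M * Wᴴ) * Lᴴ).trace.re + (L * M * Lᴴ).trace.re := by
  have hsq : 0 ≤ ((L * W - V * L) * M * (L * W - V * L)ᴴ).trace.re :=
    (Complex.le_def.mp (hM.mul_mul_conjTranspose_same _).trace_nonneg).1
  have hcross : (V * (L * (M * Wᴴ) * Lᴴ)).trace.re = (Vᴴ * (L * (W * M) * Lᴴ)).trace.re := by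
    rw [← Complex.conj_re, ← Complex.star_def, ← Matrix.trace_conjTranspose, Matrix.trace_mul_comm]
    simp only [Matrix.conjTranspose_mul, Matrix.conjTranspose_conjTranspose, hM.isHermitian.eq,
      mul_assoc]
  have hlast : (V * (L * M * Lᴴ) * Vᴴ).trace = (L * M * Lᴴ).trace := by
    rw [Matrix.trace_mul_comm, conjTranspose_mul_mul_cancel hV]
  have hexpand : (L * W - V * L) * M * (L * W - V * L)ᴴ =
      L * (W * M * Wᴴ) * Lᴴ + V * (L * M * Lᴴ) * Vᴴ -
        (L * (W * M) * Lᴴ * Vᴴ + V * (L * (M * Wᴴ) * Lᴴ)) := by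
    simp only [Matrix.conjTranspose_sub, Matrix.conjTranspose_mul]
    noncomm_ring
  rw [hexpand, Matrix.trace_sub, Matrix.trace_add, Matrix.trace_add, hlast,
    Matrix.trace_mul_comm _ Vᴴ, Complex.sub_re, Complex.add_re, Complex.add_re, hcross] at hsq
  linarith

theorem IsCP.two_mul_re_trace_mul_apply_le {Φ : SuperOp n} (hΦ : IsCP Φ) (W : Matrix n n ℂ)
    {V M : Matrix n n ℂ} (hV : V ∈ Matrix.unitaryGroup n ℂ) (hM : M.PosSemidef) :
    2 * (Vᴴ * Φ (W * M)).trace.re ≤ (Φ (W * M * Wᴴ)).trace.re + (Φ M).trace.re := by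
  obtain ⟨L, hL⟩ := hΦ.exists_kraus
  simp only [hL, Finset.mul_sum, Matrix.trace_sum, Complex.re_sum, ← Finset.sum_add_distrib]
  exact Finset.sum_le_sum fun r _ => two_mul_re_trace_mul_le (L r) W hV hM

theorem IsCP.re_trace_conjTranspose_mul_apply_le {Φ : SuperOp n} (hΦ : IsCP Φ) {c : ℝ}
    (htr : ∀ X, (Φ X).trace = c * X.trace) {V : Matrix n n ℂ} (hV : V ∈ Matrix.unitaryGroup n ℂ)
    (X : Matrix n n ℂ) : (Vᴴ * Φ X).trace.re ≤ c * traceNorm X := by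
  obtain ⟨W, hW, M, hM, hMtr, rfl⟩ := exists_polar_decomposition X
  have hWM : (W * M * Wᴴ).trace = M.trace := by
    rw [Matrix.trace_mul_comm, conjTranspose_mul_mul_cancel hW]
  have hmain := hΦ.two_mul_re_trace_mul_apply_le W hV hM
  rw [htr, htr, hWM, hMtr, ← Complex.ofReal_mul, Complex.ofReal_re] at hmain
  linarith

theorem IsCP.traceNorm_apply_le {Φ : SuperOp n} (hΦ : IsCP Φ) {c : ℝ}
    (htr : ∀ X, (Φ X).trace = c * X.trace) (X : Matrix n n ℂ) :
    traceNorm (Φ X) ≤ c * traceNorm X := by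
  obtain ⟨V, hV, P, -, hPtr, hΦX⟩ := exists_polar_decomposition (Φ X)
  have hmain := hΦ.re_trace_conjTranspose_mul_apply_le htr hV X
  rwa [hΦX, conjTranspose_mul_mul_cancel hV, hPtr, Complex.ofReal_re] at hmain

theorem re_trace_conjTranspose_mul_le_traceNorm {V : Matrix n n ℂ}
    (hV : V ∈ Matrix.unitaryGroup n ℂ) (A : Matrix n n ℂ) : (Vᴴ * A).trace.re ≤ traceNorm A := by
  simpa using IsCP.one.re_trace_conjTranspose_mul_apply_le (c := 1) (by simp) hV A

theorem traceNorm_nonneg (A : Matrix n n ℂ) : 0 ≤ traceNorm A :=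
  Finset.sum_nonneg fun _ _ => Real.sqrt_nonneg _

theorem eq_zero_of_traceNorm_eq_zero {A : Matrix n n ℂ} (hA : traceNorm A = 0) : A = 0 := by
  obtain ⟨W, -, M, hM, hMtr, rfl⟩ := exists_polar_decomposition A
  rw [hA, Complex.ofReal_zero, hM.trace_eq_zero_iff] at hMtr
  rw [hMtr, mul_zero]

theorem traceNorm_smul_of_norm_eq_one {c : ℂ} (hc : ‖c‖ = 1) (A : Matrix n n ℂ) :
    traceNorm (c • A) = traceNorm A := by
  have hsq : (c • A)ᴴ * (c • A) = Aᴴ * A := by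
    rw [Matrix.conjTranspose_smul, smul_mul_smul_comm, Complex.star_def, Complex.conj_mul', hc]
    simp
  simp only [traceNorm, hsq]

theorem traceNorm_sub_le (A B : Matrix n n ℂ) : traceNorm (A - B) ≤ traceNorm A + traceNorm B := by
  obtain ⟨V, hV, P, -, hPtr, hAB⟩ := exists_polar_decomposition (A - B)
  have hP : P = Vᴴ * A + Vᴴ * (-1 : ℂ) • B := by
    rw [neg_one_smul, ← mul_add, ← sub_eq_add_neg, hAB, conjTranspose_mul_mul_cancel hV]
  calc traceNorm (A - B) = (Vᴴ * A).trace.re + (Vᴴ * (-1 : ℂ) • B).trace.re := by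
        rw [← Complex.add_re, ← Matrix.trace_add, ← hP, hPtr, Complex.ofReal_re]
    _ ≤ traceNorm A + traceNorm ((-1 : ℂ) • B) :=
        add_le_add (re_trace_conjTranspose_mul_le_traceNorm hV A)
          (re_trace_conjTranspose_mul_le_traceNorm hV _)
    _ = traceNorm A + traceNorm B := by rw [traceNorm_smul_of_norm_eq_one (by simp)]

theorem traceNorm_of_posSemidef {P : Matrix n n ℂ} (hP : P.PosSemidef) :
    traceNorm P = P.trace.re := by
  apply le_antisymm
  · obtain ⟨V, hV, M, -, hMtr, hPV⟩ := exists_polar_decomposition P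
    have hM : Vᴴ * P = M := by rw [hPV, conjTranspose_mul_mul_cancel hV]
    have hmain := IsCP.one.two_mul_re_trace_mul_apply_le 1 hV hP
    simp only [Module.End.one_apply, one_mul, hM, hMtr, Matrix.conjTranspose_one, mul_one,
      Complex.ofReal_re] at hmain
    linarith
  · simpa using re_trace_conjTranspose_mul_le_traceNorm (one_mem (Matrix.unitaryGroup n ℂ)) P

theorem IsDensity.traceNorm_eq_one {σ : Matrix n n ℂ} (hσ : IsDensity σ) : traceNorm σ = 1 := by
  rw [traceNorm_of_posSemidef hσ.1, hσ.2, Complex.one_re]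

theorem IsCPTP.traceNorm_sub_one_apply_le {Φ : SuperOp n} (hΦ : IsCPTP Φ) (X : Matrix n n ℂ) :
    traceNorm ((Φ - 1) X) ≤ 2 * traceNorm X := by
  have hΦX : traceNorm (Φ X) ≤ 1 * traceNorm X :=
    hΦ.isCP.traceNorm_apply_le (fun Y => by rw [hΦ.2, Complex.ofReal_one, one_mul]) X
  have hsub := traceNorm_sub_le (Φ X) X
  rw [LinearMap.sub_apply, Module.End.one_apply]
  linarith

end TraceNorm

section Semigroup

theorem exists_exp_sub_one_eq_mul {A : Type*} [NormedRing A] [NormedAlgebra ℂ A] [CompleteSpace A]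
    (x : A) : ∃ y, NormedSpace.exp x - 1 = x * y ∧ ∀ z, Commute x z → Commute y z := by
  have hsummable : Summable fun k : ℕ => ((k + 1).factorial⁻¹ : ℂ) • x ^ k := by
    refine .of_norm_bounded (NormedSpace.norm_expSeries_summable' (𝕂 := ℂ) x) fun k => ?_
    rw [norm_smul, norm_smul, norm_inv, norm_inv, Complex.norm_natCast, Complex.norm_natCast]
    gcongr
    exact k.le_succ
  refine ⟨∑' k : ℕ, ((k + 1).factorial⁻¹ : ℂ) • x ^ k, ?_, fun z hxz => ?_⟩
  · have hexp := NormedSpace.exp_series_hasSum_exp' (𝕂 := ℂ) x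
    rw [← hexp.tsum_eq, hexp.summable.tsum_eq_zero_add, ← hsummable.tsum_mul_left]
    simp [pow_succ']
  · exact (Commute.tsum_right z fun k => ((hxz.pow_left k).smul_left _).symm).symm

theorem hasSum_pow_div_factorial_smul {V : Type*} [AddCommGroup V] [Module ℂ V]
    [TopologicalSpace V] [ContinuousSMul ℂ V] (t c : ℂ) (v : V) :
    HasSum (fun k : ℕ => (t ^ k / (k.factorial : ℂ)) • c ^ k • v) (Complex.exp (t * c) • v) := by
  have hexp := (NormedSpace.expSeries_div_hasSum_exp (𝔸 := ℂ) (t * c)).smul_const v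
  simpa only [smul_smul, div_mul_eq_mul_div, ← mul_pow, Complex.exp_eq_exp_ℂ] using hexp

theorem isClosed_setOf_posSemidef {m : Type*} [Finite m] :
    IsClosed {X : Matrix m m ℂ | X.PosSemidef} := by
  have := Fintype.ofFinite m
  simp only [Matrix.posSemidef_iff_dotProduct_mulVec, Set.ofPred_and, Set.ofPred_forall]
  exact (isClosed_eq (by fun_prop) continuous_id).inter
    (isClosed_iInter fun x => isClosed_le continuous_const (by fun_prop))

theorem isCP_of_hasSum_apply {n : Type} [Finite n] {ι : Type*} {f : ι → SuperOp n} {Φ : SuperOp n}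
    (hf : ∀ j, IsCP (f j)) (hsum : ∀ X, HasSum (fun j => f j X) (Φ X)) : IsCP Φ := by
  intro k X hX
  have hampl : HasSum (fun j => ampliation k (f j) X) (ampliation k Φ X) :=
    Pi.hasSum.2 fun p => Pi.hasSum.2 fun q => Pi.hasSum.1 (Pi.hasSum.1 (hsum _) p.2) q.2
  exact isClosed_setOf_posSemidef.mem_of_tendsto hampl (.of_forall fun s =>
    Matrix.posSemidef_sum s fun j _ => hf j k X hX)

variable {n : Type} [Fintype n] [DecidableEq n]

/-- The matrix of a superoperator in the standard basis of the operator space. -/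
noncomputable abbrev superMatrix : SuperOp n ≃ₐ[ℂ] Matrix (n × n) (n × n) ℂ :=
  LinearMap.toMatrixAlgEquiv (Matrix.stdBasis ℂ n n)

theorem superMatrix_semigroup (Φ : SuperOp n) (t : ℝ) :
    superMatrix (semigroup Φ t) = NormedSpace.exp ((t : ℂ) • superMatrix Φ) :=
  AlgEquiv.apply_symm_apply _ _

theorem exists_semigroup_sub_one_eq_mul (Φ : SuperOp n) (t : ℝ) :
    ∃ H, semigroup Φ t - 1 = Φ * H ∧ ∀ Ψ, Commute Φ Ψ → Commute H Ψ := by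
  let : NormedRing (Matrix (n × n) (n × n) ℂ) := Matrix.linftyOpNormedRing
  let : NormedAlgebra ℂ (Matrix (n × n) (n × n) ℂ) := Matrix.linftyOpNormedAlgebra
  obtain ⟨y, hy, hcomm⟩ := exists_exp_sub_one_eq_mul ((t : ℂ) • superMatrix Φ)
  refine ⟨superMatrix.symm ((t : ℂ) • y), superMatrix.injective ?_, fun Ψ hΨ => ?_⟩
  · rw [map_sub, superMatrix_semigroup, map_one, map_mul, AlgEquiv.apply_symm_apply,
      mul_smul_comm, ← smul_mul_assoc]
    exact hy
  · have hyΨ := (hcomm _ ((hΨ.map superMatrix).smul_left (t : ℂ))).smul_left (t : ℂ)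
    simpa using hyΨ.map superMatrix.symm

theorem semigroup_add_of_commute {Φ Ψ : SuperOp n} (h : Commute Φ Ψ) (t : ℝ) :
    semigroup (Φ + Ψ) t = semigroup Φ t * semigroup Ψ t := by
  apply superMatrix.injective
  rw [map_mul, superMatrix_semigroup, superMatrix_semigroup, superMatrix_semigroup, map_add,
    smul_add]
  exact Matrix.exp_add_of_commute _ _
    (((h.map superMatrix).smul_left (t : ℂ)).smul_right (t : ℂ))

theorem semigroup_list_sum_of_commute {l : List (SuperOp n)}
    (h : ∀ Φ ∈ l, ∀ Ψ ∈ l, Commute Φ Ψ) (t : ℝ) :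
    semigroup l.sum t = (l.map fun Φ => semigroup Φ t).prod := by
  induction l with
  | nil => exact superMatrix.injective (by simp [superMatrix_semigroup])
  | cons Φ l ih =>
    rw [List.sum_cons, List.map_cons, List.prod_cons, semigroup_add_of_commute, ih]
    · exact fun Ψ hΨ Ω hΩ => h Ψ (by simp [hΨ]) Ω (by simp [hΩ])
    · exact Commute.list_sum_right _ _ fun Ψ hΨ => h Φ (by simp) Ψ (by simp [hΨ])

theorem hasSum_semigroup_apply (Φ : SuperOp n) (t : ℝ) (X : Matrix n n ℂ) :
    HasSum (fun k : ℕ => ((t : ℂ) ^ k / (k.factorial : ℂ)) • (Φ ^ k) X) (semigroup Φ t X) := by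
  let evalAt : Matrix (n × n) (n × n) ℂ →ₗ[ℂ] Matrix n n ℂ :=
    LinearMap.applyₗ X ∘ₗ superMatrix.symm.toLinearMap
  have hterm (k : ℕ) : superMatrix (((t : ℂ) ^ k / (k.factorial : ℂ)) • Φ ^ k) =
      (k.factorial : ℂ)⁻¹ • ((t : ℂ) • superMatrix Φ) ^ k := by
    rw [map_smul, map_pow, smul_pow, smul_smul, div_eq_inv_mul]
  have hexp : HasSum (fun k : ℕ => superMatrix (((t : ℂ) ^ k / (k.factorial : ℂ)) • Φ ^ k))
      (superMatrix (semigroup Φ t)) := by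
    simp only [hterm, superMatrix_semigroup]
    let : NormedRing (Matrix (n × n) (n × n) ℂ) := Matrix.linftyOpNormedRing
    let : NormedAlgebra ℂ (Matrix (n × n) (n × n) ℂ) := Matrix.linftyOpNormedAlgebra
    exact NormedSpace.exp_series_hasSum_exp' _
  simpa [evalAt, Function.comp_def] using
    hexp.map evalAt evalAt.continuous_of_finiteDimensional

theorem semigroup_apply_of_apply_eq_smul {Φ : SuperOp n} {μ : ℂ} {X : Matrix n n ℂ}
    (hX : Φ X = μ • X) (t : ℝ) : semigroup Φ t X = Complex.exp (t * μ) • X := by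
  have hpow (k : ℕ) : (Φ ^ k) X = μ ^ k • X := by
    induction k with
    | zero => simp
    | succ k ih => rw [pow_succ', Module.End.mul_apply, ih, map_smul, hX, smul_smul, pow_succ]
  refine (hasSum_semigroup_apply Φ t X).unique ?_
  simpa only [hpow] using hasSum_pow_div_factorial_smul (t : ℂ) μ X

theorem trace_semigroup_apply {Φ : SuperOp n} {c : ℂ} (hΦ : ∀ X, (Φ X).trace = c * X.trace)
    (t : ℝ) (X : Matrix n n ℂ) : (semigroup Φ t X).trace = Complex.exp (t * c) * X.trace := by
  have hpow (k : ℕ) : ((Φ ^ k) X).trace = c ^ k * X.trace := by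
    induction k with
    | zero => simp
    | succ k ih => rw [pow_succ', Module.End.mul_apply, hΦ, ih, pow_succ', mul_assoc]
  have hsum := (hasSum_semigroup_apply Φ t X).map (Matrix.traceLinearMap n ℂ ℂ)
    (Matrix.traceLinearMap n ℂ ℂ).continuous_of_finiteDimensional
  refine hsum.unique ?_
  simpa [Function.comp_def, hpow] using hasSum_pow_div_factorial_smul (t : ℂ) c X.trace

theorem semigroup_sub_one_eq_exp_smul (Φ : SuperOp n) (t : ℝ) :
    semigroup (Φ - 1) t = (Real.exp (-t) : ℂ) • semigroup Φ t := by
  have hneg : semigroup (-1 : SuperOp n) t = (Real.exp (-t) : ℂ) • 1 := by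
    refine LinearMap.ext fun X => ?_
    rw [semigroup_apply_of_apply_eq_smul (μ := -1) (by simp)]
    simp
  rw [sub_eq_add_neg, semigroup_add_of_commute (Commute.neg_one_right Φ), hneg, mul_smul_comm,
    mul_one]

theorem IsCP.semigroup_sub_one {Φ : SuperOp n} (hΦ : IsCP Φ) {t : ℝ} (ht : 0 ≤ t) :
    IsCP (semigroup Φ t - 1) := by
  let term (j : ℕ) : SuperOp n := ((t : ℂ) ^ (j + 1) / ((j + 1).factorial : ℂ)) • Φ ^ (j + 1)
  refine isCP_of_hasSum_apply (f := term) (fun j => (hΦ.pow _).smul ?_) fun X => ?_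
  · exact_mod_cast (by positivity : (0 : ℝ) ≤ t ^ (j + 1) / (j + 1).factorial)
  · simpa [term] using (hasSum_nat_add_iff' 1).2 (hasSum_semigroup_apply Φ t X)

end Semigroup

section Equilibrium

theorem inf_maxGenEigenspace_eq_bot {R M : Type*} [CommRing R] [AddCommGroup M] [Module R M]
    {f : Module.End R M} {W : Submodule R M} (hW : ∀ x ∈ W, f x ∈ W) {μ : R}
    (hμ : ∀ x ∈ W, f x = μ • x → x = 0) : W ⊓ f.maxGenEigenspace μ = ⊥ := by
  have hrestrict : ¬Module.End.HasEigenvalue (f.restrict hW) μ := fun h => by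
    obtain ⟨x, hx, hx0⟩ := h.exists_hasEigenvector
    rw [Module.End.mem_eigenspace_iff] at hx
    exact hx0 (Subtype.ext (hμ x x.2 (congrArg Subtype.val hx)))
  have hbot : Module.End.genEigenspace (f.restrict hW) μ ⊤ = ⊥ :=
    not_not.1 fun h => hrestrict (Module.End.HasUnifEigenvalue.lt one_pos h)
  rw [Module.End.maxGenEigenspace, Submodule.inf_genEigenspace f W hW, hbot, Submodule.map_bot]

theorem ker_le_peripheralSpace {n : Type} (G : SuperOp n) :
    LinearMap.ker G ≤ peripheralSpace G := by
  rw [← Module.End.eigenspace_zero]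
  exact ((G.genEigenspace 0).mono le_top).trans
    (le_iSup₂_of_le (f := fun μ (_ : μ ∈ {μ : ℂ | μ.re = 0}) => G.maxGenEigenspace μ) 0
      Complex.zero_re le_rfl)

variable {n : Type} [Fintype n] {G : SuperOp n} {ρ : Matrix n n ℂ}

theorem ker_trace_le_nonperipheralSpace (htr : ∀ X, (G X).trace = 0)
    (hG : ∀ (μ : ℂ) (X : Matrix n n ℂ), μ.re = 0 → X.trace = 0 → G X = μ • X → X = 0) :
    LinearMap.ker (Matrix.traceLinearMap n ℂ ℂ) ≤ nonperipheralSpace G := by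
  have hinvariant : ∀ X ∈ LinearMap.ker (Matrix.traceLinearMap n ℂ ℂ),
      G X ∈ LinearMap.ker (Matrix.traceLinearMap n ℂ ℂ) := fun X _ => htr X
  rw [Submodule.eq_iSup_inf_genEigenspace ⊤ hinvariant (G.iSup_maxGenEigenspace_eq_top)]
  refine iSup_le fun μ => ?_
  by_cases hμ : μ.re = 0
  · exact (inf_maxGenEigenspace_eq_bot hinvariant fun X hX => hG μ X hμ hX).trans_le bot_le
  · exact inf_le_right.trans (le_iSup₂_of_le μ hμ le_rfl)

theorem isUniqueEquilibrium_of_forall_eigenvector (htr : ∀ X, (G X).trace = 0) (hρ : ρ.trace = 1)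
    (hGρ : G ρ = 0)
    (hG : ∀ (μ : ℂ) (X : Matrix n n ℂ), μ.re = 0 → X.trace = 0 → G X = μ • X → X = 0) :
    IsUniqueEquilibrium G ρ where
  stationary := hGρ
  unique σ hσ hGσ := sub_eq_zero.1 <| hG 0 (σ - ρ) Complex.zero_re
    (by rw [Matrix.trace_sub, hσ.2, hρ, sub_self]) (by rw [map_sub, hGσ, hGρ, sub_zero, zero_smul])
  peripheral X := by
    have hleft : X.trace • ρ ∈ peripheralSpace G :=
      Submodule.smul_mem _ _ (ker_le_peripheralSpace G hGρ)
    have hright : X - X.trace • ρ ∈ nonperipheralSpace G :=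
      ker_trace_le_nonperipheralSpace htr hG (by simp [hρ])
    calc peripheralProj G X
        = peripheralProj G (X.trace • ρ) + peripheralProj G (X - X.trace • ρ) := by
          rw [← map_add, add_sub_cancel]
      _ = X.trace • ρ := by
          rw [peripheralProj, Submodule.projection_apply_of_mem_left _ hleft,
            Submodule.projection_apply_of_mem_right _ hright, add_zero]

variable [DecidableEq n] {t r : ℝ}

theorem isUniqueEquilibrium_of_traceNorm_semigroup_apply_le (htr : ∀ X, (G X).trace = 0)
    (hρ : ρ.trace = 1) (hGρ : G ρ = 0) (hr : r < 1)
    (hcontr : ∀ X : Matrix n n ℂ, X.trace = 0 →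
      traceNorm (semigroup G t X) ≤ r * traceNorm X) : IsUniqueEquilibrium G ρ := by
  refine isUniqueEquilibrium_of_forall_eigenvector htr hρ hGρ fun μ X hμ hX hGX => ?_
  have hphase : ‖Complex.exp (t * μ)‖ = 1 := by simp [Complex.norm_exp, hμ]
  have hle := hcontr X hX
  rw [semigroup_apply_of_apply_eq_smul hGX, traceNorm_smul_of_norm_eq_one hphase] at hle
  exact eq_zero_of_traceNorm_eq_zero (by nlinarith [traceNorm_nonneg X])

theorem IsUniqueEquilibrium.contractionCoeff_le (hG : IsUniqueEquilibrium G ρ)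
    (htr : ∀ X, (G X).trace = 0) (hρ : IsDensity ρ) (hr : 0 ≤ r)
    (hcontr : ∀ X : Matrix n n ℂ, X.trace = 0 →
      traceNorm (semigroup G t X) ≤ r * traceNorm X) : contractionCoeff G t ≤ r := by
  have hfix : semigroup G t ρ = ρ := by
    rw [semigroup_apply_of_apply_eq_smul (μ := 0) (by rw [hG.stationary, zero_smul]), mul_zero,
      Complex.exp_zero, one_smul]
  suffices hsup : ∀ σ, IsDensity σ →
      traceNorm (semigroup G t σ - peripheralProj G (semigroup G t σ)) ≤ 2 * r by
    have hle : contractionCoeff G t ≤ 1 / 2 * (2 * r) :=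
      mul_le_mul_of_nonneg_left
        (Real.sSup_le (fun _ ⟨σ, hσ, hx⟩ => hx.trans_le (hsup σ hσ)) (by positivity)) (by norm_num)
    linarith
  intro σ hσ
  have htrace : (semigroup G t σ).trace = 1 := by
    simpa [hσ.2] using trace_semigroup_apply (c := 0) (by simpa using htr) t σ
  calc traceNorm (semigroup G t σ - peripheralProj G (semigroup G t σ))
      = traceNorm (semigroup G t (σ - ρ)) := by
        rw [hG.peripheral, htrace, one_smul, map_sub, hfix]
    _ ≤ r * traceNorm (σ - ρ) := hcontr _ (by rw [Matrix.trace_sub, hσ.2, hρ.2, sub_self])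
    _ ≤ r * (traceNorm σ + traceNorm ρ) := by gcongr; exact traceNorm_sub_le σ ρ
    _ = 2 * r := by rw [hσ.traceNorm_eq_one, hρ.traceNorm_eq_one]; ring

end Equilibrium

section Preparation

variable {n : Type} [Fintype n]

/-- The superoperator `X ↦ tr(X) ρ`, which replaces every density operator by `ρ`. -/
noncomputable def prepare (ρ : Matrix n n ℂ) : SuperOp n :=
  (Matrix.traceLinearMap n ℂ ℂ).smulRight ρ

theorem prepare_apply (ρ X : Matrix n n ℂ) : prepare ρ X = X.trace • ρ := rfl

theorem eq_prepare_of_forall_isDensity {Φ : SuperOp n} {ρ : Matrix n n ℂ}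
    (h : ∀ σ, IsDensity σ → Φ σ = ρ) : Φ = prepare ρ := by
  classical
  have hposSemidef {P : Matrix n n ℂ} (hP : P.PosSemidef) : Φ P = prepare ρ P := by
    rcases eq_or_ne P.trace 0 with hP0 | hP0
    · rw [hP.trace_eq_zero_iff.1 hP0, map_zero, map_zero]
    · have hdensity : IsDensity (P.trace⁻¹ • P) :=
        ⟨hP.smul (inv_nonneg.2 hP.trace_nonneg), by
          rw [Matrix.trace_smul, smul_eq_mul, inv_mul_cancel₀ hP0]⟩
      rw [prepare_apply, ← h _ hdensity, map_smul, smul_inv_smul₀ hP0]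
  open scoped MatrixOrder Matrix.Norms.L2Operator in
  exact LinearMap.ext_on CStarAlgebra.span_nonneg fun P hP =>
    hposSemidef (Matrix.nonneg_iff_posSemidef.1 hP)

theorem prepare_mul {Φ : SuperOp n} {c : ℂ} (hΦ : ∀ X, (Φ X).trace = c * X.trace)
    (ρ : Matrix n n ℂ) : prepare ρ * Φ = c • prepare ρ := by
  refine LinearMap.ext fun X => ?_
  rw [Module.End.mul_apply, LinearMap.smul_apply, prepare_apply, prepare_apply, hΦ, mul_smul]

end Preparation

section CommutingProducts

theorem list_prod_map_mul_of_commute {ι M : Type*} [Monoid M] {f g : ι → M}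
    (h : ∀ i j, Commute (g i) (f j)) (l : List ι) :
    (l.map fun i => f i * g i).prod = (l.map f).prod * (l.map g).prod := by
  induction l with
  | nil => simp
  | cons i l ih =>
    have hcomm : Commute (g i) (l.map f).prod :=
      Commute.list_prod_right _ _ (List.forall_mem_map.2 fun j _ => h i j)
    rw [List.map_cons, List.prod_cons, ih, List.map_cons, List.prod_cons, List.map_cons,
      List.prod_cons, hcomm.mul_mul_mul_comm]

variable {n : Type} {ι : Type*}

theorem isCP_list_prod_map_sub {Φ Ψ : ι → SuperOp n} (hΨ : ∀ i, IsCP (Ψ i))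
    (hsub : ∀ i, IsCP (Φ i - Ψ i)) (l : List ι) :
    IsCP ((l.map Φ).prod - (l.map Ψ).prod) := by
  induction l with
  | nil => simpa using IsCP.zero
  | cons i l ih =>
    have hΦ (j) : IsCP (Φ j) := by simpa using (hsub j).add (hΨ j)
    have hprod : IsCP (l.map Φ).prod := IsCP.list_prod (List.forall_mem_map.2 fun j _ => hΦ j)
    have htelescope : (Φ i - Ψ i) * (l.map Φ).prod + Ψ i * ((l.map Φ).prod - (l.map Ψ).prod) =
        Φ i * (l.map Φ).prod - Ψ i * (l.map Ψ).prod := by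
      rw [sub_mul, mul_sub, sub_add_sub_cancel]
    rw [List.map_cons, List.prod_cons, List.map_cons, List.prod_cons, ← htelescope]
    exact ((hsub i).mul hprod).add ((hΨ i).mul ih)

variable [Fintype n]

theorem trace_list_prod_map_apply {Φ : ι → SuperOp n} {c : ℂ}
    (hΦ : ∀ i X, (Φ i X).trace = c * X.trace) (l : List ι) (X : Matrix n n ℂ) :
    ((l.map Φ).prod X).trace = c ^ l.length * X.trace := by
  induction l with
  | nil => simp
  | cons i l ih =>
    rw [List.map_cons, List.prod_cons, Module.End.mul_apply, hΦ, ih, List.length_cons, pow_succ',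
      mul_assoc]

variable [DecidableEq n]

theorem IsCPTP.exists_exp_smul_semigroup_sub_one_eq_mul {Φ : SuperOp n} (hΦ : IsCPTP Φ) (t : ℝ) :
    ∃ H : SuperOp n, (Real.exp (-t) : ℂ) • (semigroup Φ t - 1) = Φ * H ∧
      (∀ X, (H X).trace = ((1 - Real.exp (-t) : ℝ) : ℂ) * X.trace) ∧
      ∀ Ψ, Commute Φ Ψ → Commute H Ψ := by
  obtain ⟨H, hH, hcomm⟩ := exists_semigroup_sub_one_eq_mul Φ t
  have hmul : (Real.exp (-t) : ℂ) • (semigroup Φ t - 1) = Φ * (Real.exp (-t) : ℂ) • H := by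
    rw [hH, mul_smul_comm]
  refine ⟨(Real.exp (-t) : ℂ) • H, hmul, fun X => ?_, fun Ψ hΨ => (hcomm Ψ hΨ).smul_left _⟩
  have hexp : (Real.exp (-t) : ℂ) * Complex.exp t = 1 := by
    rw [Complex.ofReal_exp, ← Complex.exp_add, Complex.ofReal_neg, neg_add_cancel,
      Complex.exp_zero]
  rw [← hΦ.2, ← Module.End.mul_apply, ← hmul, LinearMap.smul_apply, Matrix.trace_smul,
    LinearMap.sub_apply, Matrix.trace_sub, trace_semigroup_apply (c := 1) (by simpa using hΦ.2),
    Module.End.one_apply, mul_one, smul_eq_mul, mul_sub, ← mul_assoc, hexp]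
  push_cast
  ring

theorem semigroup_sum_sub_one_of_commute {K : ℕ} {E : Fin K → SuperOp n}
    (hE : ∀ j k, Commute (E j) (E k)) (t : ℝ) :
    semigroup (∑ k, (E k - 1)) t =
      ((List.finRange K).map fun k => semigroup (E k - 1) t).prod := by
  rw [← List.sum_ofFn, List.ofFn_eq_map, semigroup_list_sum_of_commute, List.map_map]
  · rfl
  · exact List.forall_mem_map.2 fun j _ => List.forall_mem_map.2 fun k _ =>
      ((hE j k).sub_left (Commute.one_left _)).sub_right (Commute.one_right _)

end CommutingProducts

section CommutingPreparation

variable {n : Type} [Fintype n] {K : ℕ} {E : Fin K → SuperOp n} {ρ : Matrix n n ℂ}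

/-- The channels `E k` commute with each other, and their composition prepares the state `ρ`. -/
structure IsCommutingPreparation (E : Fin K → SuperOp n) (ρ : Matrix n n ℂ) : Prop where
  isCPTP : ∀ k, IsCPTP (E k)
  commute : ∀ j k, Commute (E j) (E k)
  isDensity : IsDensity ρ
  prod_eq : (List.ofFn E).prod = prepare ρ

namespace IsCommutingPreparation

theorem apply_self (hE : IsCommutingPreparation E ρ) (k : Fin K) : E k ρ = ρ := by
  have hcomm : Commute (E k) (prepare ρ) := by
    rw [← hE.prod_eq]
    exact Commute.list_prod_right _ _ (by simpa [List.forall_mem_ofFn_iff] using hE.commute k)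
  have hρ := LinearMap.congr_fun hcomm.eq ρ
  simpa [prepare_apply, (hE.isCPTP k).2, hE.isDensity.2] using hρ

theorem sum_sub_one_apply_self (hE : IsCommutingPreparation E ρ) : (∑ k, (E k - 1)) ρ = 0 := by
  simp [LinearMap.sum_apply, hE.apply_self]

theorem trace_sum_sub_one_apply (hE : IsCommutingPreparation E ρ) (X : Matrix n n ℂ) :
    ((∑ k, (E k - 1)) X).trace = 0 := by
  simp [LinearMap.sum_apply, Matrix.trace_sum, (hE.isCPTP _).2]

theorem eq_zero_of_trace_eq_zero_of_injective (hE : IsCommutingPreparation E ρ)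
    (hinj : ∀ k, Function.Injective (E k)) {X : Matrix n n ℂ} (hX : X.trace = 0) : X = 0 := by
  have hunit : IsUnit (List.ofFn E).prod := List.prod_isUnit <| List.forall_mem_ofFn_iff.2 fun k =>
    (Module.End.isUnit_iff _).2 ⟨hinj k, LinearMap.surjective_of_injective (hinj k)⟩
  refine ((Module.End.isUnit_iff _).1 hunit).injective ?_
  rw [hE.prod_eq, prepare_apply, hX, zero_smul, map_zero]

section Semigroup

variable [DecidableEq n] {t : ℝ}

theorem trace_semigroup_apply (hE : IsCommutingPreparation E ρ) (t : ℝ) (X : Matrix n n ℂ) :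
    (semigroup (∑ k, (E k - 1)) t X).trace = X.trace := by
  simpa using QLMixing.trace_semigroup_apply (c := 0)
    (by simpa using hE.trace_sum_sub_one_apply) t X

theorem prod_exp_smul_semigroup_sub_one (hE : IsCommutingPreparation E ρ) (t : ℝ) :
    ((List.finRange K).map fun k => (Real.exp (-t) : ℂ) • (semigroup (E k) t - 1)).prod =
      ((1 - Real.exp (-t) : ℝ) : ℂ) ^ K • prepare ρ := by
  choose H hmul htr hcomm using fun k =>
    (hE.isCPTP k).exists_exp_smul_semigroup_sub_one_eq_mul t
  simp only [hmul]
  rw [list_prod_map_mul_of_commute fun i j => hcomm i _ (hE.commute i j), ← List.ofFn_eq_map,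
    hE.prod_eq, prepare_mul (trace_list_prod_map_apply htr _), List.length_finRange]

theorem isCP_semigroup_sub (hE : IsCommutingPreparation E ρ) (ht : 0 ≤ t) :
    IsCP (semigroup (∑ k, (E k - 1)) t - ((1 - Real.exp (-t) : ℝ) : ℂ) ^ K • prepare ρ) := by
  have hexp : (0 : ℂ) ≤ Real.exp (-t) := by exact_mod_cast (Real.exp_pos _).le
  rw [semigroup_sum_sub_one_of_commute hE.commute, ← hE.prod_exp_smul_semigroup_sub_one t]
  refine isCP_list_prod_map_sub
    (fun k => ((hE.isCPTP k).isCP.semigroup_sub_one ht).smul hexp) (fun k => ?_) _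
  rw [semigroup_sub_one_eq_exp_smul, smul_sub, sub_sub_cancel]
  exact IsCP.one.smul hexp

theorem isCPTP_semigroup (hE : IsCommutingPreparation E ρ) (ht : 0 ≤ t) :
    IsCPTP (semigroup (∑ k, (E k - 1)) t) := by
  refine ⟨?_, hE.trace_semigroup_apply t⟩
  rw [semigroup_sum_sub_one_of_commute hE.commute]
  refine IsCP.list_prod (List.forall_mem_map.2 fun k _ => ?_)
  rw [semigroup_sub_one_eq_exp_smul]
  have hCP := ((hE.isCPTP k).isCP.semigroup_sub_one ht).add IsCP.one
  rw [sub_add_cancel] at hCP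
  exact hCP.smul (by exact_mod_cast (Real.exp_pos _).le)

theorem traceNorm_semigroup_apply_le (hE : IsCommutingPreparation E ρ) (ht : 0 ≤ t)
    {X : Matrix n n ℂ} (hX : X.trace = 0) :
    traceNorm (semigroup (∑ k, (E k - 1)) t X) ≤ K * Real.exp (-t) * traceNorm X := by
  have hbernoulli : 1 - (1 - Real.exp (-t)) ^ K ≤ K * Real.exp (-t) := by
    have := one_add_mul_le_pow (a := -Real.exp (-t))
      (by linarith [Real.exp_le_one_iff.2 (neg_nonpos.2 ht)]) K
    rw [← sub_eq_add_neg] at this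
    linarith
  let R := semigroup (∑ k, (E k - 1)) t - ((1 - Real.exp (-t) : ℝ) : ℂ) ^ K • prepare ρ
  have htr (Y : Matrix n n ℂ) :
      (R Y).trace = ((1 - (1 - Real.exp (-t)) ^ K : ℝ) : ℂ) * Y.trace := by
    rw [LinearMap.sub_apply, Matrix.trace_sub, hE.trace_semigroup_apply, LinearMap.smul_apply,
      prepare_apply, smul_smul, Matrix.trace_smul, hE.isDensity.2]
    push_cast
    ring
  calc traceNorm (semigroup (∑ k, (E k - 1)) t X) = traceNorm (R X) := by
        rw [LinearMap.sub_apply, LinearMap.smul_apply, prepare_apply, hX, zero_smul, smul_zero,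
          sub_zero]
    _ ≤ (1 - (1 - Real.exp (-t)) ^ K) * traceNorm X :=
        (hE.isCP_semigroup_sub ht).traceNorm_apply_le htr X
    _ ≤ K * Real.exp (-t) * traceNorm X :=
        mul_le_mul_of_nonneg_right hbernoulli (traceNorm_nonneg X)

end Semigroup

theorem isUniqueEquilibrium (hE : IsCommutingPreparation E ρ) :
    IsUniqueEquilibrium (∑ k, (E k - 1)) ρ := by
  classical
  obtain ⟨t, ht, hlt⟩ : ∃ t : ℝ, 0 ≤ t ∧ K * Real.exp (-t) < 1 := by
    have hlim := Real.tendsto_exp_neg_atTop_nhds_zero.const_mul (K : ℝ)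
    rw [mul_zero] at hlim
    exact ((Filter.eventually_ge_atTop 0).and (hlim.eventually_lt_const one_pos)).exists
  exact isUniqueEquilibrium_of_traceNorm_semigroup_apply_le hE.trace_sum_sub_one_apply
    hE.isDensity.2 hE.sum_sub_one_apply_self hlt fun _ => hE.traceNorm_semigroup_apply_le ht

theorem contractionCoeff_le [DecidableEq n] (hE : IsCommutingPreparation E ρ) {ν : ℝ}
    (hν : ∀ k, (E k).HasEigenvalue 0 → ν ≤ 1) {t : ℝ} (ht : 0 ≤ t) :
    contractionCoeff (∑ k, (E k - 1)) t ≤ K * Real.exp (-ν * t) := by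
  refine hE.isUniqueEquilibrium.contractionCoeff_le hE.trace_sum_sub_one_apply hE.isDensity
    (by positivity) fun X hX => ?_
  by_cases hinj : ∀ k, Function.Injective (E k)
  · have hX0 := hE.eq_zero_of_trace_eq_zero_of_injective hinj hX
    simp [hX0, traceNorm_of_posSemidef Matrix.PosSemidef.zero]
  · obtain ⟨k, hk⟩ := not_forall.1 hinj
    have hν1 : ν ≤ 1 := hν k (by
      rwa [Module.End.HasEigenvalue, Module.End.HasUnifEigenvalue, ← Module.End.eigenspace,
        Module.End.eigenspace_zero, Ne, LinearMap.ker_eq_bot])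
    calc traceNorm (semigroup (∑ k, (E k - 1)) t X) ≤ K * Real.exp (-t) * traceNorm X :=
          hE.traceNorm_semigroup_apply_le ht hX
      _ ≤ K * Real.exp (-ν * t) * traceNorm X := by
          gcongr
          · exact traceNorm_nonneg X
          · nlinarith

end IsCommutingPreparation

end CommutingPreparation

theorem isDensity_pureState {n : Type} [Fintype n] {ψ : EuclideanSpace ℂ n} (hψ : ‖ψ‖ = 1) :
    IsDensity (pureState ψ) := by
  refine ⟨Matrix.posSemidef_vecMulVec_self_star (R := ℂ) (ψ : n → ℂ), ?_⟩
  calc (pureState ψ).trace = inner ℂ ψ ψ := by rw [PiLp.inner_apply]; rfl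
    _ = 1 := by rw [inner_self_eq_norm_sq_to_K, hψ, RCLike.ofReal_one, one_pow]

theorem MadeRFTSBy.isCommutingPreparation {N d K : ℕ} {nbhd : Fin K → Finset (Fin N)}
    {ψ : EuclideanSpace ℂ (Config N d)} {E : Fin K → SuperOp (Config N d)}
    (hE : MadeRFTSBy nbhd ψ E) (hψ : ‖ψ‖ = 1) (hcomm : ∀ j k, Commute (E j) (E k)) :
    IsCommutingPreparation E (pureState ψ) where
  isCPTP k := (hE.neighborhoodMap k).isCPTP
  commute := hcomm
  isDensity := isDensity_pureState hψ
  prod_eq := eq_prepare_of_forall_isDensity (hE.attractive 1)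

theorem MadeRFTSBy.isBoundedQLLiouvillian {N d K : ℕ} {nbhd : Fin K → Finset (Fin N)}
    {ψ : EuclideanSpace ℂ (Config N d)} {E : Fin K → SuperOp (Config N d)}
    (hE : MadeRFTSBy nbhd ψ E) : IsBoundedQLLiouvillian nbhd 2 (∑ k, (E k - 1)) :=
  ⟨fun k => E k - 1, rfl, fun k => ⟨(hE.neighborhoodMap k).isNeighborhoodLiouvillian,
    (hE.neighborhoodMap k).isCPTP.traceNorm_sub_one_apply_le⟩⟩

end QLMixing

theorem mainTheorem11_general (F : QLMixing.ScalableFamily)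
    (E : (s : ℕ) → Fin (F.K s) → QLMixing.SuperOp (QLMixing.Config (F.N s) F.d))
    (hRFTS : ∀ s, QLMixing.MadeRFTSBy (F.nbhd s) (F.ψ s) (E s))
    (hcomm : ∀ s j k, Commute (E s j) (E s k))
    (ν : ℝ) (hν : 0 < ν)
    (hν_le_one : ∀ s k, Module.End.HasEigenvalue (E s k) 0 → ν ≤ 1) :
    (∃ C : ℝ, ∀ s, QLMixing.IsBoundedQLLiouvillian (F.nbhd s) C (∑ k, (E s k - 1))) ∧
    ∃ c : ℝ, QLMixing.IsRapidlyMixing F (fun s => ∑ k, (E s k - 1)) c 1 ν := by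
  have hE (s) := (hRFTS s).isCommutingPreparation (F.norm_ψ s) (hcomm s)
  obtain ⟨b, hb, hK⟩ := F.card_nbhds
  refine ⟨⟨2, fun s => (hRFTS s).isBoundedQLLiouvillian⟩, b, hb, one_pos, hν,
    fun s _ ht => (hE s).isCPTP_semigroup ht, fun s => (hE s).isUniqueEquilibrium, fun s t ht => ?_⟩
  calc QLMixing.contractionCoeff (∑ k, (E s k - 1)) t ≤ F.K s * Real.exp (-ν * t) :=
        (hE s).contractionCoeff_le (hν_le_one s) ht
    _ ≤ b * (F.N s : ℝ) ^ (1 : ℝ) * Real.exp (-ν * t) := by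
        rw [Real.rpow_one]
        gcongr
        exact hK s

theorem mainTheorem11 (F : QLMixing.ScalableFamily)
    (E : (s : ℕ) → Fin (F.K s) → QLMixing.SuperOp (QLMixing.Config (F.N s) F.d))
    (hRFTS : ∀ s, QLMixing.MadeRFTSBy (F.nbhd s) (F.ψ s) (E s))
    (hcomm : ∀ s j k, Commute (E s j) (E s k))
    (ν : ℝ) (hν : 0 < ν)
    (hgap : ∀ s k (μ : ℂ), Module.End.HasEigenvalue (E s k) μ → μ = 1 ∨ ‖μ‖ < 1 - ν) :
    (∃ C : ℝ, ∀ s, QLMixing.IsBoundedQLLiouvillian (F.nbhd s) C (∑ k, (E s k - 1))) ∧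
    ∃ c : ℝ, QLMixing.IsRapidlyMixing F (fun s => ∑ k, (E s k - 1)) c 1 ν :=
  mainTheorem11_general F E hRFTS hcomm ν hν fun s k h0 =>
    (sub_pos.1 ((norm_nonneg _).trans_lt ((hgap s k 0 h0).resolve_left zero_ne_one))).le
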